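/- Let $\Gamma=(N,\{S_i\}_{i\in N},\{u_i\}_{i\in N})$ be a finite normal form game: a finite set $N$ of players, finite nonempty action sets $S_i$, and utilities $u_i:S=\prod_{j\in N}S_j\to\mathbb R$. For a player $i$ and a profile $\sigma\in S_{-i}=\prod_{j\ne i}S_j$ of opponent actions, write $a\succeq_{\sigma}b$ (for $a,b\in S_i$) if $u_i(a,\sigma)\ge u_i(b,\sigma)$, and $a\succ_\sigma b$ if $a\succeq_\sigma b$ but not $b\succeq_\sigma a$. The utility $u_i$ is *strategically separable* if there are functions $g_{ij}:S_i\times S_j\to\mathbb R$ $(j\neq i)$ such that $v_i(s)=\sum_{j\ne i}g_{ij}(s_i,s_j)$ induces the same family of orders, i.e. for all $\sigma\in S_{-i}$ and $a,b\in S_i$ one has $a\succeq_\sigma b$ if and only if $v_i(a,\sigma)\ge v_i(b,\sigma)$. A *balanced sequence* of length $m$ for $u_i$ is a sequence of pairs of profiles $(r^k,t^k)\in S\times S$, $k=1,\dots,m$, such that (1) $r^k_{-i}=t^k_{-i}$ for every $k$; (2) $r^k_i\succeq_{r^k_{-i}}t^k_i$ for every $k$, with strict preference for at least one $k$; (3)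 for each $j\ne i$, each pair $(a,b)\in S_i\times S_j$ appears the same number of times in the sequence $(r^1_i,r^1_j),\dots,(r^m_i,r^m_j)$ as in $(t^1_i,t^1_j),\dots,(t^m_i,t^m_j)$. Then for every integer $L\ge 1$ there are a finite normal form game $\Gamma$ and a player $i$ of $\Gamma$ such that $u_i$ is not strategically separable and yet $u_i$ has no balanced sequence of length $m\le L$. -/

import Mathlib

/-- A normal form game with set of players `N` and action sets `S j`: every player `i` has a
utility `utility i` on the set of action profiles. -/
structure NormalFormGame (N : Type*) (S : N → Type*) where
  utility : N → (∀ j, S j) → ℝ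

namespace NormalFormGame

/-- Profiles of actions of the opponents of player `i`. -/
abbrev OppProfile {N : Type*} (S : N → Type*) (i : N) : Type _ :=
  ∀ j : {j : N // j ≠ i}, S j

/-- The part of an action profile that belongs to the opponents of `i`. -/
def opp {N : Type*} {S : N → Type*} (i : N) (s : ∀ j, S j) : OppProfile S i :=
  fun j => s j

/-- The profile in which player `i` plays `a` and the opponents of `i` play `σ`. -/
def join {N : Type*} [DecidableEq N] {S : N → Type*} (i : N) (a : S i) (σ : OppProfile S i) :
    ∀ j, S j :=
  (Equiv.piSplitAt i S).symm (a, σ)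

/-- The family of orders on the actions of player `i` that the utility `u` induces, one order for
each profile `σ` of opponent actions: `inducedFamily i u σ a b` says that `a` is weakly preferred
to `b` when the opponents play `σ`. -/
def inducedFamily {N : Type*} [DecidableEq N] {S : N → Type*} (i : N) (u : (∀ j, S j) → ℝ) :
    OppProfile S i → S i → S i → Prop :=
  fun σ a b => u (join i b σ) ≤ u (join i a σ)

/-- Two utilities of player `i` are strategically equivalent if they induce the same family of
orders on the actions of `i`. -/
def StrategicallyEquivalent {N : Type*} [DecidableEq N] {S : N → Type*} (i : N)
    (u v : (∀ j, S j) → ℝ) : Prop :=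
  ∀ (σ : OppProfile S i) (a b : S i), inducedFamily i u σ a b ↔ inducedFamily i v σ a b

/-- `v` is additively separable across the opponents of player `i`. -/
def AdditivelySeparable {N : Type*} [Fintype N] [DecidableEq N] {S : N → Type*} (i : N)
    (v : (∀ j, S j) → ℝ) : Prop :=
  ∃ g : ∀ j : {j : N // j ≠ i}, S i → S j → ℝ, ∀ s, v s = ∑ j, g j (s i) (s j)

/-- The preferences of player `i` are strategically separable. -/
def StrategicallySeparable {N : Type*} [Fintype N] [DecidableEq N] {S : N → Type*}
    (Γ : NormalFormGame N S) (i : N) : Prop :=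
  ∃ v : (∀ j, S j) → ℝ, AdditivelySeparable i v ∧ StrategicallyEquivalent i (Γ.utility i) v

/-- The pairs of profiles `(r k, t k)`, `k < m`, form a balanced sequence (of length `m`) for the
family `P` of preference orders of player `i`. -/
structure IsBalancedSequence {N : Type*} {S : N → Type*} (i : N)
    (P : OppProfile S i → S i → S i → Prop) {m : ℕ} (r t : Fin m → ∀ j, S j) : Prop where
  opp_eq : ∀ k, opp i (r k) = opp i (t k)
  weak : ∀ k, P (opp i (r k)) (r k i) (t k i)
  strict : ∃ k, P (opp i (r k)) (r k i) (t k i) ∧ ¬ P (opp i (r k)) (t k i) (r k i)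
  balanced : ∀ j : N, j ≠ i → ∀ (a : S i) (b : S j),
    Nat.card {k : Fin m // r k i = a ∧ r k j = b} = Nat.card {k : Fin m // t k i = a ∧ t k j = b}

end NormalFormGame

namespace NormalFormGame

/-! Three opponents act in `Fin (L + 1)`, read cyclically, and the payoff advantage of action `0` is
`perturbedForm`. It is positive at each `(x, x - 1, x)` and negative at each `(x, x, x - 1)`. Over
all `x` these two families have the same marginals, so no separable function has these signs. Yet
the separable `sidonForm` agrees weakly with them and vanishes only on the two families, so a
balanced sequence changes the indicator of action `0` only there. Matching marginals then links `x`
to `x + 1`, and closing the cycle takes all `L + 1` values. -/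

/-- Powers of three form a Sidon set. -/
theorem three_pow_add_three_pow_eq :
    ∀ {a b c d : ℕ}, 3 ^ a + 3 ^ b = 3 ^ c + 3 ^ d → (a = c ∧ b = d) ∨ (a = d ∧ b = c) := by
  have key : ∀ {a b c d : ℕ}, a ≤ b → c ≤ d → 3 ^ a + 3 ^ b = 3 ^ c + 3 ^ d → c ≤ a := by
    intro a b c d hab hcd h
    by_contra! hac
    obtain ⟨b, rfl⟩ := Nat.exists_eq_add_of_le hab
    obtain ⟨c, rfl⟩ := Nat.exists_eq_add_of_lt hac
    obtain ⟨d, rfl⟩ := Nat.exists_eq_add_of_le hcd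
    have h' : 3 ^ a * (1 + 3 ^ b) = 3 ^ a * (3 * (3 ^ c + 3 ^ (c + d))) := by
      rw [show 3 ^ a * (1 + 3 ^ b) = 3 ^ a + 3 ^ (a + b) by ring, h]; ring
    have h'' := Nat.eq_of_mul_eq_mul_left (by positivity) h'
    -- Modulo 3 the left side is 2 or 1, while the right side is 0.
    rcases b with _ | b
    · omega
    · rw [pow_succ] at h''; omega
  have sorted : ∀ {a b c d : ℕ}, a ≤ b → c ≤ d → 3 ^ a + 3 ^ b = 3 ^ c + 3 ^ d →
      a = c ∧ b = d := by
    intro a b c d hab hcd h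
    obtain rfl : a = c := le_antisymm (key hcd hab h.symm) (key hab hcd h)
    exact ⟨rfl, Nat.pow_right_injective (a := 3) (by decide) (Nat.add_left_cancel h)⟩
  intro a b c d h
  rcases le_total a b with hab | hab <;> rcases le_total c d with hcd | hcd
  · exact .inl (sorted hab hcd h)
  · exact .inr (sorted hab hcd (by omega))
  · exact .inr (sorted hab hcd (by omega)).symm
  · exact .inl (sorted hab hcd (by omega)).symm

/-- Along a balanced sequence, every function of the actions of `i` and of one opponent has the
same sum over both sides. -/
theorem IsBalancedSequence.sum_eq {N : Type*} {S : N → Type*} {i : N}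
    {P : OppProfile S i → S i → S i → Prop} {m : ℕ} {r t : Fin m → ∀ j, S j}
    (h : IsBalancedSequence i P r t) {j : N} (hj : j ≠ i) [Fintype (S i)] [Fintype (S j)]
    (G : S i → S j → ℝ) : ∑ k, G (r k i) (r k j) = ∑ k, G (t k i) (t k j) := by
  classical
  have expand : ∀ q : Fin m → ∀ j, S j, ∑ k, G (q k i) (q k j) =
      ∑ p : S i × S j, (Nat.card {k : Fin m // q k i = p.1 ∧ q k j = p.2} : ℝ) * G p.1 p.2 := by
    intro q
    rw [← Finset.sum_fiberwise Finset.univ (fun k => (q k i, q k j))]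
    refine Finset.sum_congr rfl fun p _ => ?_
    rw [Finset.sum_congr rfl (g := fun _ => G p.1 p.2), Finset.sum_const, nsmul_eq_mul,
      Nat.card_eq_fintype_card, Fintype.card_subtype]
    · simp [Prod.ext_iff]
    · rintro k hk
      obtain rfl := (Finset.mem_filter.1 hk).2
      rfl
  rw [expand, expand]
  simp only [h.balanced j hj]

/-- If player `0` has three opponents, all with action set `A`, a sum over the opponents has three
terms. -/
theorem sum_opponents_four (F : {j : Fin 4 // j ≠ 0} → ℝ) :
    ∑ j, F j = F ⟨1, by decide⟩ + F ⟨2, by decide⟩ + F ⟨3, by decide⟩ := by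
  rw [← (finSuccAboveEquiv (0 : Fin 4)).sum_comp F, Fin.sum_univ_three]
  rfl

section Cyclic

variable {L : ℕ}

/-- An additively separable function of the actions of three opponents, whose zeros are exactly
`(x, x - 1, x)` and `(x, x, x - 1)`. -/
def sidonForm (x y z : Fin (L + 1)) : ℝ :=
  3 ^ (y : ℕ) + 3 ^ (z : ℕ) - (3 ^ (x : ℕ) + 3 ^ ((x - 1 : Fin (L + 1)) : ℕ))

theorem sidonForm_eq_zero {x y z : Fin (L + 1)} (h : sidonForm x y z = 0) :
    (y = x - 1 ∧ z = x) ∨ (y = x ∧ z = x - 1) := by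
  have h' : 3 ^ (y : ℕ) + 3 ^ (z : ℕ) = 3 ^ (x : ℕ) + 3 ^ ((x - 1 : Fin (L + 1)) : ℕ) := by
    have := sub_eq_zero.1 h
    exact_mod_cast this
  simpa only [Fin.val_inj, or_comm] using three_pow_add_three_pow_eq h'

/-- The function `sidonForm` with its zeros resolved to `1` and `-1`. -/
def perturbedForm (x y z : Fin (L + 1)) : ℝ :=
  if y = x - 1 ∧ z = x then 1 else if y = x ∧ z = x - 1 then -1 else sidonForm x y z

theorem sub_one_ne_self (hL : 1 ≤ L) (x : Fin (L + 1)) : x - 1 ≠ x := by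
  obtain ⟨L, rfl⟩ := Nat.exists_eq_add_of_le' hL
  simp

theorem perturbedForm_pos (x : Fin (L + 1)) : perturbedForm x (x - 1) x = 1 := by
  simp [perturbedForm]

theorem perturbedForm_neg (hL : 1 ≤ L) (x : Fin (L + 1)) : perturbedForm x x (x - 1) = -1 := by
  simp [perturbedForm, sub_one_ne_self hL]

/-- The two forms differ only where `sidonForm` vanishes, so weak preferences in the game survive in
a separable utility. -/
theorem mul_sidonForm_nonneg {x y z : Fin (L + 1)} {d : ℝ} (h : 0 ≤ d * perturbedForm x y z) :
    0 ≤ d * sidonForm x y z := by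
  have zero_pos : sidonForm x (x - 1) x = 0 := by simp only [sidonForm]; ring
  have zero_neg : sidonForm x x (x - 1) = 0 := by simp only [sidonForm]; ring
  unfold perturbedForm at h
  split_ifs at h with h1 h2
  · rw [h1.1, h1.2, zero_pos, mul_zero]
  · rw [h2.1, h2.2, zero_neg, mul_zero]
  · exact h

/-- The game in which only player `0` has a nonconstant utility: action `0` yields
`perturbedForm` of the actions of the opponents, every other action yields `0`. -/
def cyclicGame (L : ℕ) : NormalFormGame (Fin 4) (fun _ => Fin (L + 1)) where
  utility i s := if i = 0 then (if s 0 = 0 then 1 else 0) * perturbedForm (s 1) (s 2) (s 3) else 0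

theorem cyclicGame_inducedFamily (s : Fin 4 → Fin (L + 1)) (a b : Fin (L + 1)) :
    inducedFamily 0 ((cyclicGame L).utility 0) (opp 0 s) a b ↔
      0 ≤ ((if a = 0 then 1 else 0) - (if b = 0 then 1 else 0) : ℝ) *
        perturbedForm (s 1) (s 2) (s 3) := by
  rw [sub_mul, sub_nonneg]
  simp [inducedFamily, cyclicGame, join, opp, Equiv.piSplitAt]

theorem cyclicGame_not_separable (hL : 1 ≤ L) : ¬ (cyclicGame L).StrategicallySeparable 0 := by
  rintro ⟨v, ⟨g, hg⟩, hv⟩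
  have h10 : (1 : Fin (L + 1)) ≠ 0 := by simpa using (sub_one_ne_self hL 1).symm
  let D : {j : Fin 4 // j ≠ 0} → Fin (L + 1) → ℝ := fun j b => g j 0 b - g j 1 b
  have hD : ∀ (s : Fin 4 → Fin (L + 1)) (a : Fin (L + 1)),
      v (join (S := fun _ => Fin (L + 1)) 0 a (opp 0 s)) = g ⟨1, by decide⟩ a (s 1) +
        g ⟨2, by decide⟩ a (s 2) + g ⟨3, by decide⟩ a (s 3) := by
    intro s a
    rw [hg, sum_opponents_four]
    simp [join, opp, Equiv.piSplitAt]
  have hpos : ∀ x : Fin (L + 1),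
      0 < D ⟨1, by decide⟩ x + D ⟨2, by decide⟩ (x - 1) + D ⟨3, by decide⟩ x := by
    intro x
    -- The leading `0` is a dummy that `opp` discards.
    have h := (hv (opp 0 ![0, x, x - 1, x]) 1 0).not
    rw [cyclicGame_inducedFamily, inducedFamily, hD, hD] at h
    have := h.1 (by simp [h10, perturbedForm_pos])
    simp [D] at this ⊢
    linarith
  have hneg : ∀ x : Fin (L + 1),
      D ⟨1, by decide⟩ x + D ⟨2, by decide⟩ x + D ⟨3, by decide⟩ (x - 1) < 0 := by
    intro x
    have h := (hv (opp 0 ![0, x, x, x - 1]) 0 1).not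
    rw [cyclicGame_inducedFamily, inducedFamily, hD, hD] at h
    have := h.1 (by simp [h10, perturbedForm_neg hL])
    simp [D] at this ⊢
    linarith
  -- Summed over the cycle, the shift by one disappears and both families give the same total.
  have hp := Finset.sum_pos (fun x _ => hpos x) Finset.univ_nonempty
  have hn := Finset.sum_neg (fun x _ => hneg x) Finset.univ_nonempty
  have shift : ∀ j, ∑ x, D j (x - 1) = ∑ x, D j x := fun j =>
    (Equiv.subRight (1 : Fin (L + 1))).sum_comp (D j)
  simp only [Finset.sum_add_distrib, shift] at hp hn
  linarith

open scoped Fin.NatCast Fin.CommRing in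
theorem cyclicGame_lt_length (hL : 1 ≤ L) {m : ℕ} {r t : Fin m → Fin 4 → Fin (L + 1)}
    (h : IsBalancedSequence 0 (inducedFamily 0 ((cyclicGame L).utility 0)) r t) : L < m := by
  let d : Fin m → ℝ := fun k => (if r k 0 = 0 then 1 else 0) - (if t k 0 = 0 then 1 else 0)
  have hopp : ∀ k j, j ≠ 0 → t k j = r k j := fun k j hj =>
    (congrFun (h.opp_eq k) ⟨j, hj⟩).symm
  have hsum : ∀ j, j ≠ 0 → ∀ G : Fin (L + 1) → ℝ, ∑ k, d k * G (r k j) = 0 := by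
    intro j hj G
    have := h.sum_eq hj fun a b => (if a = 0 then 1 else 0) * G b
    simp only [hopp _ j hj] at this
    simp only [d, sub_mul, Finset.sum_sub_distrib, this, sub_self]
  have hweak : ∀ k, 0 ≤ d k * perturbedForm (r k 1) (r k 2) (r k 3) := fun k =>
    (cyclicGame_inducedFamily _ _ _).1 (h.weak k)
  -- By separability the total is zero, and every term is nonnegative.
  have hzero : ∀ k, d k * sidonForm (r k 1) (r k 2) (r k 3) = 0 := by
    have htotal : ∑ k, d k * sidonForm (r k 1) (r k 2) (r k 3) = 0 := by
      have h1 := hsum 1 (by decide) fun x => 3 ^ (x : ℕ) + 3 ^ ((x - 1 : Fin (L + 1)) : ℕ)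
      have h2 := hsum 2 (by decide) fun x => 3 ^ (x : ℕ)
      have h3 := hsum 3 (by decide) fun x => 3 ^ (x : ℕ)
      simp only [sidonForm, mul_sub, mul_add, Finset.sum_add_distrib, Finset.sum_sub_distrib]
        at h1 h2 h3 ⊢
      linarith
    intro k
    exact (Finset.sum_eq_zero_iff_of_nonneg fun k _ => mul_sidonForm_nonneg (hweak k)).1 htotal k
      (Finset.mem_univ k)
  have pos_type : ∀ k, 0 < d k → r k 2 = r k 1 - 1 := by
    intro k hk
    rcases sidonForm_eq_zero ((mul_eq_zero.1 (hzero k)).resolve_left hk.ne') with h1 | h1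
    · exact h1.1
    · have := hweak k
      rw [h1.1, h1.2, perturbedForm_neg hL] at this
      linarith
  have neg_type : ∀ k, d k < 0 → r k 2 = r k 1 := by
    intro k hk
    rcases sidonForm_eq_zero ((mul_eq_zero.1 (hzero k)).resolve_left hk.ne) with h1 | h1
    · have := hweak k
      rw [h1.1, h1.2, perturbedForm_pos] at this
      linarith
    · exact h1.1
  -- The weights `d` on a fixed action of opponent `j` cancel, so a positive one needs a negative
  -- partner.
  have exists_neg : ∀ j, j ≠ 0 → ∀ k, 0 < d k → ∃ l, d l < 0 ∧ r l j = r k j := by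
    intro j hj k hk
    by_contra! hl
    have := Finset.sum_pos' (s := Finset.univ)
      (f := fun l => d l * if r l j = r k j then 1 else 0)
      (fun l _ => by
        split_ifs with hlk
        · simpa using not_lt.1 fun hneg => hl l hneg hlk
        · simp) ⟨k, Finset.mem_univ k, by simpa using hk⟩
    exact this.ne' (hsum j hj fun b => if b = r k j then 1 else 0)
  have exists_pos : ∀ j, j ≠ 0 → ∀ k, d k < 0 → ∃ l, 0 < d l ∧ r l j = r k j := by
    intro j hj k hk
    by_contra! hl
    have := Finset.sum_neg' (s := Finset.univ)
      (f := fun l => d l * if r l j = r k j then 1 else 0)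
      (fun l _ => by
        split_ifs with hlk
        · simpa using not_lt.1 fun hpos => hl l hpos hlk
        · simp) ⟨k, Finset.mem_univ k, by simpa using hk⟩
    exact this.ne (hsum j hj fun b => if b = r k j then 1 else 0)
  have hstart : ∃ k, 0 < d k := by
    obtain ⟨k, -, hk⟩ := h.strict
    have hk0 : d k ≠ 0 := by
      intro h0
      refine hk ((cyclicGame_inducedFamily _ _ _).2 ?_)
      rw [← neg_sub, show ((if r k 0 = 0 then 1 else 0) - (if t k 0 = 0 then 1 else 0) : ℝ) = 0
        from h0]
      simp
    rcases hk0.lt_or_gt with hk0 | hk0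
    · obtain ⟨l, hl, -⟩ := exists_pos 1 (by decide) k hk0
      exact ⟨l, hl⟩
    · exact ⟨k, hk0⟩
  -- From `(x, x - 1, x)`, matching opponent 1 leads to `(x, x, x - 1)`; matching opponent 2 then
  -- leads to `(x + 1, x, x + 1)`.
  have hstep : ∀ k, 0 < d k → ∃ l, 0 < d l ∧ r l 1 = r k 1 + 1 := by
    intro k hk
    obtain ⟨l, hl, hlk⟩ := exists_neg 1 (by decide) k hk
    obtain ⟨l', hl', hll'⟩ := exists_pos 2 (by decide) l hl
    refine ⟨l', hl', ?_⟩
    rw [pos_type l' hl', neg_type l hl, hlk] at hll'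
    exact sub_eq_iff_eq_add.1 hll'
  obtain ⟨k₀, hk₀⟩ := hstart
  have hall : ∀ n : ℕ, ∃ k, 0 < d k ∧ r k 1 = r k₀ 1 + n • 1 := by
    intro n
    induction n with
    | zero => exact ⟨k₀, hk₀, by simp⟩
    | succ n ih =>
      obtain ⟨k, hk, hkn⟩ := ih
      obtain ⟨l, hl, hlk⟩ := hstep k hk
      exact ⟨l, hl, by rw [hlk, hkn, succ_nsmul, add_assoc]⟩
  have hsurj : Function.Surjective fun k => r k 1 := by
    intro x
    obtain ⟨k, -, hk⟩ := hall (x - r k₀ 1 : Fin (L + 1))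
    refine ⟨k, hk.trans ?_⟩
    rw [nsmul_one, Fin.cast_val_eq_self, add_sub_cancel]
  simpa using Fintype.card_le_of_surjective _ hsurj

end Cyclic

end NormalFormGame

theorem mainTheorem8 (L : ℕ) (hL : 1 ≤ L) :
    ∃ (N : Type) (_ : Fintype N) (_ : DecidableEq N) (S : N → Type)
      (_ : ∀ j, Finite (S j)) (_ : ∀ j, Nonempty (S j)) (Γ : NormalFormGame N S) (i : N),
      ¬ Γ.StrategicallySeparable i ∧
        ∀ m : ℕ, m ≤ L → ∀ r t : Fin m → ∀ j, S j,
          ¬ NormalFormGame.IsBalancedSequence i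
              (NormalFormGame.inducedFamily i (Γ.utility i)) r t := by
  exact ⟨Fin 4, inferInstance, inferInstance, fun _ => Fin (L + 1), fun _ => inferInstance,
    fun _ => inferInstance, NormalFormGame.cyclicGame L, 0,
    NormalFormGame.cyclicGame_not_separable hL,
    fun _ hm _ _ h => hm.not_gt (NormalFormGame.cyclicGame_lt_length hL h)⟩
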